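/- **Setting.** Fix $p\ge 1$, $\tau\in(0,1)$ and $K^*\ge 0$. For each sample size $n$ observe $Y_i=\mathbf x_i^\top\beta^*_i+\varepsilon_i$, $1\le i\le n$, with $\mathbf x_i,\beta_i^*\in\mathbb R^p$ (both may depend on $n$), the first component of every $\mathbf x_i$ being one and the same nonzero constant $c^{(0)}$. For $\beta=(\beta_1,\dots,\beta_n)\in(\mathbb R^p)^n$ let $\mathcal A(\beta)=\{i\in\{2,\dots,n\}:\beta_i\ne\beta_{i-1}\}=\{t_1<\dots<t_m\}$, $t_0=1$, $t_{m+1}=n$, and let the $k$-th phase coefficient be $\phi_k=\beta_{t_{k-1}}$, $1\le k\le m+1$. Write $t_k^*,\phi_k^*$ for these objects at $\beta^*$, where $|\mathcal A(\beta^*)|=K^*$ does not depend on $n$ (for $n$ large), and put $I^*_{min}=\min_{1\le k\le K^*+1}(t_k^*-t_{k-1}^*)$. Let $\check\beta$ be any minimizer over $(\mathbb R^p)^n$ of $$\sum_{i=1}^n\rho_\tau(Y_i-\mathbf x_i^\top\beta_i)+n\lambda_n\sum_{i=2}^n\|\beta_i-\beta_{i-1}\|,\qquad \rho_\tau(u)=u(\tau-1_{\{u<0\}}),$$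 with $\|\cdot\|$ the Euclidean norm, and write $\check{\mathcal A}_n=\mathcal A(\check\beta)$ and $\check\phi_k$ for its phase coefficients. **Assumptions** (conditions on sequences are required for all large $n$). (A1) $\|\mathbf x_i\|\le c^{(1)}$ for all $1\le i\le n$ and all $n$, with a constant $0<c^{(1)}<1$. (A2) The $\varepsilon_i$ are i.i.d. with distribution function $F>0$ on $\mathbb R$, $\mathbb P[\varepsilon<0]=\tau$, and a bounded density $f$, which is bounded away from zero on some neighbourhood of $0$. (A3) There are constants $0<m_0\le M_0<\infty$ such that all eigenvalues of $(n_2-n_1)^{-1}\sum_{i=n_1}^{n_2-1}\mathbf x_i\mathbf x_i^\top$ lie in $[m_0,M_0]$ whenever $1\le n_1<n_2\le n$ and $n_2-n_1\ge n\delta_n$. (A4) $I^*_{min}\ge n\delta_n$, where $(\delta_n)$ is decreasing, $\delta_n\to0$ and $n\delta_n/\log n\to\infty$. (A5) There are constants $0<c^{(a)},c^{(b)}<\infty$ with $c^{(b)}<\|\phi^*_{j+1}-\phi^*_j\|<c^{(a)}$ for $1\le j\le K^*$. (A6) $K^*$ does not depend on $n$. (A7) $\delta_n,\lambda_n>0$,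 $n\lambda_n\to\infty$ and $\lambda_n/\delta_n\to0$. (A8) For each $1\le k\le K^*$ the limit $L_k=\lim_n (n\delta_n)^{-1}\sum_{i=t_k^*-[n\delta_n]}^{t_k^*-1}F(\mathbf x_i^\top(\phi^*_{k+1}-\phi^*_k))$ exists and $L_k\ne\tau$. **Theorem.** Assume (A1)–(A8) and $(n\delta_n)^{-1}I^*_{min}\to\infty$, and let $b_n=n\lambda_n/I^*_{min}+(I^*_{min})^{-1/2}$. Then, for every $k=1,\dots,K^*+1$, on the event $\{|\check{\mathcal A}_n|=K^*\}$ one has $\|\check\phi_k-\phi^*_k\|=O_{\mathbb P}(b_n)$: for every $\eta>0$ there is $C>0$ such that, for all large $n$, $$\mathbb P\big[\,|\check{\mathcal A}_n|=K^*,\ \|\check\phi_k-\phi_k^*\|>C\,b_n\big]\le\eta .$$ -/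

import Mathlib

open MeasureTheory ProbabilityTheory Filter Topology

namespace QuantileFused

/-- The space `ℝ^p` with the Euclidean norm. -/
abbrev Vec (p : ℕ) : Type := EuclideanSpace ℝ (Fin p)

/-! ### Sequences of coefficient vectors, their change-points and their phases

A vector `(β_1, …, β_n)` of elements of `ℝ^p` is a function `β : ℕ → Vec p` of which only the
values at `1, …, n` are ever used. -/

open Classical in
/-- The set of change-points `{i ∈ {2, …, n} : β_i ≠ β_{i-1}}`. -/
noncomputable def changePoints {p : ℕ} (n : ℕ) (β : ℕ → Vec p) : Finset ℕ :=
  (Finset.Icc 2 n).filter (fun i => β i ≠ β (i - 1))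

/-- The locations `t_0 = 1`, `t_1 < ⋯ < t_m` (the change-points in increasing order, `m` being
their number) and `t_{m+1} = n`. -/
noncomputable def location {p : ℕ} (n : ℕ) (β : ℕ → Vec p) (k : ℕ) : ℕ :=
  if k = 0 then 1
  else if k ≤ (changePoints n β).card then Nat.nth (fun i => i ∈ changePoints n β) (k - 1)
  else n

/-- The coefficient vector `φ_k` of the `k`-th phase, `1 ≤ k ≤ m + 1`: the value of `β` at the
first index `t_{k-1}` of the phase. -/
noncomputable def phase {p : ℕ} (n : ℕ) (β : ℕ → Vec p) (k : ℕ) : Vec p :=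
  β (location n β (k - 1))

/-- The smallest distance `min_{1 ≤ k ≤ K + 1} (t_k - t_{k-1})` for a model with `K`
change-points. -/
noncomputable def minDist {p : ℕ} (K n : ℕ) (β : ℕ → Vec p) : ℝ :=
  (Finset.Icc 1 (K + 1)).inf' (Finset.nonempty_Icc.mpr (Nat.le_add_left 1 K))
    (fun k => (location n β k : ℝ) - (location n β (k - 1) : ℝ))

/-! ### The quantile fused estimator -/

/-- The check function `ρ_τ(u) = u (τ - 1_{u < 0})`. -/
noncomputable def checkLoss (τ u : ℝ) : ℝ := u * (τ - if u < 0 then 1 else 0)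

/-- The response `Y_i = x_iᵀ β_i + ε_i`. -/
noncomputable def response {p : ℕ} (x β : ℕ → Vec p) (e : ℕ → ℝ) (i : ℕ) : ℝ :=
  inner ℝ (x i) (β i) + e i

/-- The penalized objective
`∑_{i=1}^n ρ_τ(Y_i - x_iᵀ β_i) + n λ ∑_{i=2}^n ‖β_i - β_{i-1}‖`. -/
noncomputable def objective {p : ℕ} (τ lam : ℝ) (n : ℕ) (x : ℕ → Vec p) (y : ℕ → ℝ)
    (β : ℕ → Vec p) : ℝ :=
  ∑ i ∈ Finset.Icc 1 n, checkLoss τ (y i - inner ℝ (x i) (β i))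
    + (n : ℝ) * lam * ∑ i ∈ Finset.Icc 2 n, ‖β i - β (i - 1)‖

/-- `β` is a global minimizer of the penalized objective. -/
def IsFusedEstimator {p : ℕ} (τ lam : ℝ) (n : ℕ) (x : ℕ → Vec p) (y : ℕ → ℝ)
    (β : ℕ → Vec p) : Prop :=
  ∀ γ : ℕ → Vec p, objective τ lam n x y β ≤ objective τ lam n x y γ

/-! ### Assumptions

The design `x n i` and the true coefficients `β n i`, `1 ≤ i ≤ n`, may depend on the sample
size `n`. -/

/-- The first component of every regressor is one and the same nonzero constant. -/
def HasIntercept {p : ℕ} [NeZero p] (x : ℕ → ℕ → Vec p) : Prop :=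
  ∃ c₀ : ℝ, c₀ ≠ 0 ∧ ∀ n, ∀ i ∈ Finset.Icc 1 n, x n i 0 = c₀

/-- The regressors are bounded by a constant smaller than one. -/
def BoundedDesign {p : ℕ} (x : ℕ → ℕ → Vec p) : Prop :=
  ∃ c₁ : ℝ, 0 < c₁ ∧ c₁ < 1 ∧ ∀ n, ∀ i ∈ Finset.Icc 1 n, ‖x n i‖ ≤ c₁

/-- The errors `ε_1, ε_2, …` are i.i.d. with law `ν`, `ℙ[ε < 0] = τ`, the distribution function
of `ν` is positive everywhere, and `ν` has the bounded density `f`. -/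
structure IsNoise {Ω : Type*} [MeasurableSpace Ω] (P : Measure Ω) (ε : ℕ → Ω → ℝ)
    (ν : Measure ℝ) (f : ℝ → ℝ) (τ : ℝ) : Prop where
  measurable : ∀ i, 1 ≤ i → Measurable (ε i)
  indep : iIndepFun (fun i : ℕ => ε (i + 1)) P
  law : ∀ i, 1 ≤ i → P.map (ε i) = ν
  quantile : ν.real (Set.Iio 0) = τ
  cdf_pos : ∀ u : ℝ, 0 < cdf ν u
  density_measurable : Measurable f
  density_nonneg : ∀ u, 0 ≤ f u
  density : ν = volume.withDensity (fun u => ENNReal.ofReal (f u))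
  density_bounded : ∃ B : ℝ, ∀ u, f u ≤ B

/-- The density is bounded away from zero on a neighbourhood of the quantile `0`. -/
def PositiveNearZero (f : ℝ → ℝ) : Prop :=
  ∃ f₀ > 0, ∃ η > 0, ∀ u : ℝ, |u| ≤ η → f₀ ≤ f u

/-- The matrix `(n₂ - n₁)⁻¹ ∑_{i=n₁}^{n₂-1} x_i x_iᵀ`. -/
noncomputable def designMatrix {p : ℕ} (x : ℕ → Vec p) (n₁ n₂ : ℕ) :
    Matrix (Fin p) (Fin p) ℝ :=
  ((n₂ : ℝ) - (n₁ : ℝ))⁻¹ •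
    ∑ i ∈ Finset.Ico n₁ n₂, Matrix.of (fun a b => x i a * x i b)

/-- The eigenvalues of the design matrices over all blocks of length at least `n δ_n` lie between
two positive constants. -/
def EigenvalueBounds {p : ℕ} (x : ℕ → ℕ → Vec p) (δ : ℕ → ℝ) : Prop :=
  ∃ m₀ M₀ : ℝ, 0 < m₀ ∧ m₀ ≤ M₀ ∧ ∀ᶠ n : ℕ in atTop, ∀ n₁ n₂ : ℕ,
    1 ≤ n₁ → n₁ < n₂ → n₂ ≤ n → (n : ℝ) * δ n ≤ (n₂ : ℝ) - (n₁ : ℝ) →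
      spectrum ℝ (designMatrix (x n) n₁ n₂) ⊆ Set.Icc m₀ M₀

/-- The minimal distance is at least `n δ_n`, where `δ` is (eventually) decreasing, `δ_n → 0` and
`n δ_n / log n → ∞`. -/
structure SpacingCondition {p : ℕ} (K : ℕ) (β : ℕ → ℕ → Vec p) (δ : ℕ → ℝ) : Prop where
  spacing : ∀ᶠ n : ℕ in atTop, (n : ℝ) * δ n ≤ minDist K n (β n)
  decreasing : ∃ N, AntitoneOn δ (Set.Ici N)
  tendsto_zero : Tendsto δ atTop (𝓝 0)
  log_rate : Tendsto (fun n : ℕ => (Real.log n)⁻¹ * (n * δ n)) atTop atTop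

/-- The jumps between consecutive phases are bounded, and bounded away from zero. -/
def JumpBounds {p : ℕ} (K : ℕ) (β : ℕ → ℕ → Vec p) : Prop :=
  ∃ a b : ℝ, 0 < a ∧ 0 < b ∧ ∀ᶠ n : ℕ in atTop, ∀ j ∈ Finset.Icc 1 K,
    ‖phase n (β n) (j + 1) - phase n (β n) j‖ < a ∧
      b < ‖phase n (β n) (j + 1) - phase n (β n) j‖

/-- The sequences `δ` and `λ` are (eventually) positive, `n λ_n → ∞` and `λ_n / δ_n → 0`. -/
structure TuningCondition (δ lam : ℕ → ℝ) : Prop where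
  delta_pos : ∀ᶠ n in atTop, 0 < δ n
  lam_pos : ∀ᶠ n in atTop, 0 < lam n
  tendsto_infty : Tendsto (fun n : ℕ => (n : ℝ) * lam n) atTop atTop
  ratio : Tendsto (fun n => lam n / δ n) atTop (𝓝 0)

/-- For every `1 ≤ k ≤ K` the limit `L_k` of
`(n δ_n)⁻¹ ∑_{i=t_k-[n δ_n]}^{t_k-1} F(x_iᵀ(φ_{k+1} - φ_k))` exists and differs from `τ`. -/
def Identifiability {p : ℕ} (K : ℕ) (x β : ℕ → ℕ → Vec p) (δ : ℕ → ℝ) (ν : Measure ℝ)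
    (τ : ℝ) : Prop :=
  ∀ k ∈ Finset.Icc 1 K, ∃ L : ℝ, L ≠ τ ∧
    Tendsto (fun n : ℕ => ((n : ℝ) * δ n)⁻¹ *
      ∑ i ∈ Finset.Ico (location n (β n) k - ⌊(n : ℝ) * δ n⌋₊) (location n (β n) k),
        cdf ν (inner ℝ (x n i) (phase n (β n) (k + 1) - phase n (β n) k)))
      atTop (𝓝 L)

/-! ### The rate -/

/-- `b_n = n λ_n / I + I^{-1/2}`, where `I` is the minimal distance between change-points. -/
noncomputable def rate {p : ℕ} (K : ℕ) (β : ℕ → ℕ → Vec p) (lam : ℕ → ℝ) (n : ℕ) : ℝ :=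
  (n : ℝ) * lam n / minDist K n (β n) + (Real.sqrt (minDist K n (β n)))⁻¹

/-- `X_n = O_ℙ(b_n)` on the events `A_n`: for every `η > 0` there is `C` with
`ℙ(A_n ∩ {|X_n| > C b_n}) ≤ η` for all large `n`. For `A_n` of probability tending to one this is
`X_n = O_ℙ(b_n)`. -/
def IsBigOPOn {Ω : Type*} [MeasurableSpace Ω] (P : Measure Ω) (A : ℕ → Set Ω)
    (X : ℕ → Ω → ℝ) (b : ℕ → ℝ) : Prop :=
  ∀ η : ℝ, 0 < η → ∃ C : ℝ, 0 < C ∧ ∀ᶠ n in atTop,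
    P (A n ∩ {ω | C * b n < |X n ω|}) ≤ ENNReal.ofReal η

end QuantileFused

open QuantileFused

namespace QuantileFused

/-! On a fixed block of ℓ observations inside a true phase, a minimizer that is constant there can
be moved to the true coefficient at a penalty cost of at most 2nλ times the distance, since only the
two ends of the block change (`IsFusedEstimator.sum_checkLoss_sub_le`). If the loss grows faster
than this outside a ball around the truth, the minimizer lies in the ball.
`IsNoise.exists_growth_event` provides such growth, with high probability, for a radius of order
nλ/ℓ + ℓ^{-1/2}. By convexity it suffices to treat one sphere. There the loss exceeds its tangent
line by a quadratic amount of order r²ℓ, coming from the errors of size below θr, while the centred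
linear terms are of order r√ℓ. All bounds are uniform in the direction, so Chebyshev's inequality
for finitely many empirical moments is enough.

This is applied to 2K + 1 nonrandom blocks: one of length L = ⌈nδ_n⌉ on each side of every true
change-point, and the k-th true phase with L indices removed at both ends. If the estimator had no
change-point near some true one, it would take a single value on both adjacent short blocks, close
to two coefficients that are far apart. Hence every window contains a change-point. As there are
exactly K of them, the j-th lies in the j-th window (`location_mem_window`), so the k-th estimated
phase covers the trimmed block (`eq_phase_of_close`). That block has length at least half the
minimal distance, which gives the rate. -/

/-! ### Convexity and pointwise lower bounds for the check function. -/

lemma checkLoss_eq_max (τ u : ℝ) : checkLoss τ u = max (τ * u) ((τ - 1) * u) := by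
  unfold checkLoss
  split_ifs with h
  · rw [max_eq_right (by nlinarith)]; ring
  · rw [max_eq_left (by nlinarith)]; ring

/-- Convexity of the check function, a maximum of two linear functions. -/
lemma checkLoss_sub_smul_le (τ s v : ℝ) {t : ℝ} (h0 : 0 ≤ t) (h1 : t ≤ 1) :
    checkLoss τ (s - t * v) - checkLoss τ s ≤ t * (checkLoss τ (s - v) - checkLoss τ s) := by
  simp only [checkLoss_eq_max]
  have a1 := le_max_left (τ * (s - v)) ((τ - 1) * (s - v))
  have a2 := le_max_right (τ * (s - v)) ((τ - 1) * (s - v))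
  have b1 := le_max_left (τ * s) ((τ - 1) * s)
  have b2 := le_max_right (τ * s) ((τ - 1) * s)
  set A := max (τ * (s - v)) ((τ - 1) * (s - v))
  set B := max (τ * s) ((τ - 1) * s)
  rw [sub_le_iff_le_add]
  refine max_le ?_ ?_
  · nlinarith [mul_le_mul_of_nonneg_left a1 h0, mul_le_mul_of_nonneg_left b1 (sub_nonneg.2 h1)]
  · nlinarith [mul_le_mul_of_nonneg_left a2 h0, mul_le_mul_of_nonneg_left b2 (sub_nonneg.2 h1)]

/-- The score `τ - 1_{s < 0}` of the check function. -/
noncomputable def score (τ s : ℝ) : ℝ := τ - if s < 0 then 1 else 0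

/-- The sign of `s`, with value `1` at zero. -/
noncomputable def sgn (s : ℝ) : ℝ := if s < 0 then -1 else 1

lemma checkLoss_sub_ge_score (τ s v : ℝ) :
    -v * score τ s ≤ checkLoss τ (s - v) - checkLoss τ s := by
  unfold checkLoss score
  split_ifs <;> nlinarith

/-- For s ≥ 0 the excess over the tangent line is (v - s)⁺ ≥ (v - θr)⁺, and the added term is the
parabola (v - θr)(v + r)/(2r), which lies below (v - θr)⁺ on [-r, r]. The case s < 0 is its mirror
image. The parabola is split into an even part and a part odd in v carrying the sign of s, which is
later averaged out. -/
lemma checkLoss_sub_ge_quadratic {τ r θ s v : ℝ} (hr : 0 < r)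
    (hv : |v| ≤ r) (hs : |s| < θ * r) :
    -v * score τ s + ((v ^ 2 - θ * r ^ 2) / (2 * r) + sgn s * ((1 - θ) / 2 * v))
      ≤ checkLoss τ (s - v) - checkLoss τ s := by
  obtain ⟨hv1, hv2⟩ := abs_le.1 hv
  obtain ⟨hs1, hs2⟩ := abs_lt.1 hs
  have e : (v ^ 2 - θ * r ^ 2) / (2 * r) + sgn s * ((1 - θ) / 2 * v)
      = (v ^ 2 - θ * r ^ 2 + sgn s * ((1 - θ) * r * v)) / (2 * r) := by
    field_simp
  rw [e, ← le_sub_iff_add_le', div_le_iff₀ (by positivity)]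
  unfold checkLoss score sgn
  split_ifs with h1 h2 h2
  · nlinarith [mul_nonneg (by linarith : 0 ≤ v + θ * r) (by linarith : 0 ≤ r - v)]
  · have : 0 ≤ s - v := by linarith
    rcases le_total (v + θ * r) 0 with h | h
    · nlinarith [mul_nonneg (by linarith : 0 ≤ r + v) (by linarith : 0 ≤ -(v + θ * r)), mul_pos hr (by linarith : 0 < s + θ * r)]
    · nlinarith [mul_nonneg (by linarith : 0 ≤ r - v) h]
  · rcases le_total (v - θ * r) 0 with h | h
    · nlinarith [mul_nonneg (by linarith : 0 ≤ r + v) (by linarith : 0 ≤ -(v - θ * r))]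
    · nlinarith [mul_nonneg (by linarith : 0 ≤ r - v) h, mul_pos hr (by linarith : 0 < θ * r - s)]
  · nlinarith [mul_nonneg (by linarith : 0 ≤ r + v) (by linarith : 0 ≤ (θ * r - v))]

/-- Convex combination, with weights k and 1 - k, of the quadratic and the tangent bound. The former
is needed only where k ≠ 0. -/
lemma checkLoss_sub_ge_weighted {τ r θ s v k : ℝ} (hr : 0 < r)
    (hv : |v| ≤ r) (hk0 : 0 ≤ k) (hk1 : k ≤ 1) (hs : k ≠ 0 → |s| < θ * r) :
    k * ((v ^ 2 - θ * r ^ 2) / (2 * r)) + (-score τ s + sgn s * k * ((1 - θ) / 2)) * v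
      ≤ checkLoss τ (s - v) - checkLoss τ s := by
  have h1 := checkLoss_sub_ge_score τ s v
  by_cases hk : k = 0
  · subst hk; linarith
  have h2 := checkLoss_sub_ge_quadratic (τ := τ) hr hv (hs hk)
  nlinarith [mul_le_mul_of_nonneg_left h2 hk0, mul_le_mul_of_nonneg_left h1 (sub_nonneg.2 hk1)]

/-! ### Reweighting the errors to a uniform density near zero. -/

/-- The weight `f₀ / f` on `(-h, h)`, which turns the density `f` into the constant `f₀` there. -/
noncomputable def weight (f : ℝ → ℝ) (f₀ h s : ℝ) : ℝ := if |s| < h then f₀ / f s else 0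

lemma measurable_score (τ : ℝ) : Measurable (score τ) :=
  measurable_const.sub (Measurable.ite measurableSet_Iio measurable_const measurable_const)

lemma measurable_sgn : Measurable sgn :=
  Measurable.ite measurableSet_Iio measurable_const measurable_const

lemma abs_sgn (s : ℝ) : |sgn s| = 1 := by unfold sgn; split_ifs <;> simp

lemma measurable_weight {f : ℝ → ℝ} (hf : Measurable f) (f₀ h : ℝ) : Measurable (weight f f₀ h) :=
  Measurable.ite (measurableSet_lt measurable_norm measurable_const)
    (measurable_const.div hf) measurable_const

section weight

variable {f : ℝ → ℝ} {f₀ h : ℝ}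

lemma weight_nonneg (hf₀ : 0 < f₀) (hf : ∀ s, |s| ≤ h → f₀ ≤ f s) (s : ℝ) :
    0 ≤ weight f f₀ h s := by
  unfold weight
  split_ifs with hs
  · exact div_nonneg hf₀.le (hf₀.le.trans (hf s hs.le))
  · exact le_rfl

lemma weight_le_one (hf₀ : 0 < f₀) (hf : ∀ s, |s| ≤ h → f₀ ≤ f s) (s : ℝ) :
    weight f f₀ h s ≤ 1 := by
  unfold weight
  split_ifs with hs
  · exact div_le_one_of_le₀ (hf s hs.le) (hf₀.le.trans (hf s hs.le))
  · exact zero_le_one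

lemma abs_lt_of_weight_ne_zero {s : ℝ} (hs : weight f f₀ h s ≠ 0) : |s| < h := by
  by_contra hc
  exact hs (if_neg hc)

lemma integral_mul_weight {ν : Measure ℝ} (hfm : Measurable f) (hf0 : ∀ s, 0 ≤ f s)
    (hν : ν = volume.withDensity (fun u => ENNReal.ofReal (f u)))
    (hf₀ : 0 < f₀) (hf : ∀ s, |s| ≤ h → f₀ ≤ f s) (g : ℝ → ℝ) :
    ∫ s, g s * weight f f₀ h s ∂ν = f₀ * ∫ s in Set.Ioo (-h) h, g s := by
  rw [hν, integral_withDensity_eq_integral_toReal_smul hfm.ennreal_ofReal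
    (ae_of_all _ fun _ => ENNReal.ofReal_lt_top), ← integral_const_mul,
    ← integral_indicator measurableSet_Ioo]
  congr 1
  ext s
  rw [ENNReal.toReal_ofReal (hf0 s), smul_eq_mul]
  unfold weight
  by_cases hs : |s| < h
  · have h1 : f s ≠ 0 := (hf₀.trans_le (hf s hs.le)).ne'
    rw [if_pos hs, Set.indicator_of_mem (by exact abs_lt.1 hs)]
    field_simp
  · have hm : s ∉ Set.Ioo (-h) h := fun hm => hs (abs_lt.2 hm)
    rw [if_neg hs, Set.indicator_of_notMem hm]
    simp

lemma integral_sgn_Ioo (h : ℝ) : ∫ s in Set.Ioo (-h) h, sgn s = 0 := by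
  have e := integral_sub_left_eq_self ((Set.Ioo (-h) h).indicator sgn) volume 0
  have e2 : ∀ᵐ s : ℝ, (Set.Ioo (-h) h).indicator sgn (0 - s) = -(Set.Ioo (-h) h).indicator sgn s := by
    -- Since `sgn 0 = 1`, oddness fails at the origin, a null set.
    have : ∀ᵐ s : ℝ, s ≠ 0 := by simp [ae_iff]
    filter_upwards [this] with s hs
    by_cases hm : s ∈ Set.Ioo (-h) h
    · have hm' : 0 - s ∈ Set.Ioo (-h) h := ⟨by linarith [hm.2], by linarith [hm.1]⟩
      rw [Set.indicator_of_mem hm, Set.indicator_of_mem hm']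
      unfold sgn
      rcases lt_or_gt_of_ne hs with h | h
      · rw [if_pos h, if_neg (by linarith)]; norm_num
      · rw [if_neg h.le.not_gt, if_pos (by linarith)]
    · have hm' : 0 - s ∉ Set.Ioo (-h) h := fun H => hm ⟨by linarith [H.2], by linarith [H.1]⟩
      rw [Set.indicator_of_notMem hm, Set.indicator_of_notMem hm', neg_zero]
  rw [integral_congr_ae e2, integral_neg, integral_indicator measurableSet_Ioo] at e
  linarith

end weight

/-! ### Chebyshev's inequality for the errors. -/

section chebyshev

variable {Ω : Type*} [MeasurableSpace Ω] {P : Measure Ω} [IsProbabilityMeasure P]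
  {τ : ℝ} {ε : ℕ → Ω → ℝ} {ν : Measure ℝ} {f : ℝ → ℝ}

/-- Chebyshev's inequality for weighted sums of a function of the errors. -/
lemma IsNoise.measureReal_abs_sum_ge_le (hn : IsNoise P ε ν f τ) {g : ℝ → ℝ} (hg : Measurable g)
    {M V m t : ℝ} (hM : ∀ s, |g s| ≤ M) (hm : ∫ s, g s ∂ν = m) (hV : ∫ s, g s ^ 2 ∂ν ≤ V)
    (ht : 0 < t) (J : Finset ℕ) (hJ : ∀ i ∈ J, 1 ≤ i) (c : ℕ → ℝ) (hc : ∀ i ∈ J, |c i| ≤ 1) :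
    P.real {ω | t ≤ |∑ i ∈ J, (g (ε i ω) - m) * c i|} ≤ J.card * V / t ^ 2 := by
  have hmeas : ∀ i ∈ J, Measurable (fun ω => c i * g (ε i ω)) := fun i hi =>
    (hg.comp (hn.measurable i (hJ i hi))).const_mul _
  have hlp : ∀ i ∈ J, MemLp (fun ω => c i * g (ε i ω)) 2 P := fun i hi =>
    MemLp.of_bound (hmeas i hi).aestronglyMeasurable M (ae_of_all _ fun ω => by
      rw [Real.norm_eq_abs, abs_mul]
      nlinarith [hM (ε i ω), hc i hi, abs_nonneg (g (ε i ω)), abs_nonneg (c i)])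
  have hmean : ∀ i ∈ J, ∫ ω, g (ε i ω) ∂P = m := fun i hi => by
    rw [← hm, ← hn.law i (hJ i hi), integral_map (hn.measurable i (hJ i hi)).aemeasurable
      hg.aestronglyMeasurable]
  have hsq : ∀ i ∈ J, ∫ ω, g (ε i ω) ^ 2 ∂P ≤ V := fun i hi => by
    refine le_trans (le_of_eq ?_) hV
    rw [← hn.law i (hJ i hi), integral_map (hn.measurable i (hJ i hi)).aemeasurable
      (hg.pow_const 2).aestronglyMeasurable]
  have hV0 : J.Nonempty → 0 ≤ V := fun ⟨i, hi⟩ =>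
    (integral_nonneg fun ω => sq_nonneg _).trans (hsq i hi)
  have hind : Set.Pairwise (J : Set ℕ)
      fun i j => IndepFun (fun ω => c i * g (ε i ω)) (fun ω => c j * g (ε j ω)) P := by
    intro i hi j hj hij
    have h1 := hJ i hi
    have h2 := hJ j hj
    -- Independence is stated for the shifted sequence `ε (i + 1)`, hence the indices `i - 1`.
    have h3 := hn.indep.indepFun (i := i - 1) (j := j - 1) (by omega)
    simp only [Nat.sub_add_cancel h1, Nat.sub_add_cancel h2] at h3
    exact h3.comp (hg.const_mul (c i)) (hg.const_mul (c j))
  have hvar : Var[∑ i ∈ J, fun ω => c i * g (ε i ω); P] ≤ J.card * V := by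
    rw [IndepFun.variance_sum hlp hind, ← nsmul_eq_mul]
    refine Finset.sum_le_card_nsmul _ _ _ fun i hi => ?_
    refine (variance_le_expectation_sq (hmeas i hi).aestronglyMeasurable).trans ?_
    have : ∫ ω, ((fun ω => c i * g (ε i ω)) ^ 2) ω ∂P = c i ^ 2 * ∫ ω, g (ε i ω) ^ 2 ∂P := by
      rw [← integral_const_mul]
      simp [mul_pow]
    rw [this]
    have h1 : c i ^ 2 ≤ 1 := by rw [← sq_abs]; exact pow_le_one₀ (abs_nonneg _) (hc i hi)
    nlinarith [hsq i hi, hV0 ⟨i, hi⟩, sq_nonneg (c i)]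
  have hsum : MemLp (∑ i ∈ J, fun ω => c i * g (ε i ω)) 2 P := memLp_finsetSum' J hlp
  have hE : P[∑ i ∈ J, fun ω => c i * g (ε i ω)] = ∑ i ∈ J, c i * m := by
    simp only [Finset.sum_apply]
    rw [integral_finsetSum _ fun i hi => (hlp i hi).integrable one_le_two]
    exact Finset.sum_congr rfl fun i hi => by rw [integral_const_mul, hmean i hi]
  have key := meas_ge_le_variance_div_sq hsum ht
  rw [hE] at key
  have hset : {ω | t ≤ |∑ i ∈ J, (g (ε i ω) - m) * c i|}
      = {ω | t ≤ |(∑ i ∈ J, fun ω => c i * g (ε i ω)) ω - ∑ i ∈ J, c i * m|} := by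
    congr! 4 with ω
    rw [Finset.sum_apply, ← Finset.sum_sub_distrib]
    exact Finset.sum_congr rfl fun i _ => by ring
  rw [hset, measureReal_def]
  refine ENNReal.toReal_le_of_le_ofReal ?_ (key.trans (ENNReal.ofReal_le_ofReal ?_))
  · rcases J.eq_empty_or_nonempty with rfl | hne
    · simp
    · have := hV0 hne
      positivity
  · gcongr

end chebyshev

/-! ### Moments of the weight and of the linear coefficient. -/

section weightMoments

variable {f : ℝ → ℝ} {f₀ h : ℝ} {ν : Measure ℝ}

lemma integral_weight (hfm : Measurable f) (hf0 : ∀ s, 0 ≤ f s)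
    (hν : ν = volume.withDensity (fun u => ENNReal.ofReal (f u)))
    (hf₀ : 0 < f₀) (hh : 0 ≤ h) (hf : ∀ s, |s| ≤ h → f₀ ≤ f s) :
    ∫ s, weight f f₀ h s ∂ν = f₀ * (2 * h) := by
  have := integral_mul_weight hfm hf0 hν hf₀ hf (fun _ => 1)
  simp only [one_mul] at this
  rw [this, setIntegral_const, measureReal_def, Real.volume_Ioo, ENNReal.toReal_ofReal (by linarith)]
  simp only [smul_eq_mul]; ring

lemma integrable_of_abs_le [IsProbabilityMeasure ν] {g : ℝ → ℝ} (hg : Measurable g) {M : ℝ}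
    (hM : ∀ s, |g s| ≤ M) : Integrable g ν :=
  Integrable.of_bound hg.aestronglyMeasurable M (ae_of_all _ hM)

/-- As 0 ≤ k ≤ 1, k² ≤ k. A second moment of order h, rather than 1, keeps the fluctuations small
against rℓ even though r shrinks. -/
lemma integral_sq_weight_le [IsProbabilityMeasure ν] (hfm : Measurable f) (hf0 : ∀ s, 0 ≤ f s)
    (hν : ν = volume.withDensity (fun u => ENNReal.ofReal (f u)))
    (hf₀ : 0 < f₀) (hh : 0 ≤ h) (hf : ∀ s, |s| ≤ h → f₀ ≤ f s) :
    ∫ s, weight f f₀ h s ^ 2 ∂ν ≤ f₀ * (2 * h) := by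
  have h0 := weight_nonneg (h := h) hf₀ hf
  have h1 := weight_le_one (h := h) hf₀ hf
  have hm := measurable_weight hfm f₀ h
  rw [← integral_weight hfm hf0 hν hf₀ hh hf]
  refine integral_mono (integrable_of_abs_le (hm.pow_const 2) (M := 1) fun s => ?_)
    (integrable_of_abs_le hm (M := 1) fun s => ?_) fun s => ?_
  · rw [abs_of_nonneg (sq_nonneg _)]; exact pow_le_one₀ (h0 s) (h1 s)
  · rw [abs_of_nonneg (h0 s)]; exact h1 s
  · simp only
    nlinarith [h0 s, h1 s]

/-- The coefficient of the linear term in the lower bound for the loss. -/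
noncomputable def linCoeff (τ : ℝ) (f : ℝ → ℝ) (f₀ θ h s : ℝ) : ℝ :=
  -score τ s + sgn s * weight f f₀ h s * ((1 - θ) / 2)

lemma measurable_linCoeff (hfm : Measurable f) (τ f₀ θ h : ℝ) :
    Measurable (linCoeff τ f f₀ θ h) :=
  (measurable_score τ).neg.add
    ((measurable_sgn.mul (measurable_weight hfm f₀ h)).mul_const _)

lemma abs_linCoeff_le {τ θ : ℝ} (hτ : τ ∈ Set.Ioo (0 : ℝ) 1) (hθ0 : 0 ≤ θ) (hθ1 : θ ≤ 1)
    (hf₀ : 0 < f₀) (hf : ∀ s, |s| ≤ h → f₀ ≤ f s) (s : ℝ) :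
    |linCoeff τ f f₀ θ h s| ≤ 2 := by
  have h0 := weight_nonneg (h := h) hf₀ hf s
  have h1 := weight_le_one (h := h) hf₀ hf s
  obtain ⟨a, b⟩ := hτ
  have h2 : |score τ s| ≤ 1 := by
    unfold score; split_ifs <;> rw [abs_le] <;> constructor <;> linarith
  refine (abs_add_le _ _).trans ?_
  rw [abs_neg, abs_mul, abs_mul, abs_sgn, one_mul, abs_of_nonneg h0,
    abs_of_nonneg (by linarith : 0 ≤ (1 - θ) / 2)]
  nlinarith

/-- The score is centred because τ is the mass below zero. The sign term is centred because the
reweighted density is even. -/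
lemma integral_linCoeff [IsProbabilityMeasure ν] {τ θ : ℝ}
    (hfm : Measurable f) (hf0 : ∀ s, 0 ≤ f s)
    (hν : ν = volume.withDensity (fun u => ENNReal.ofReal (f u)))
    (hq : ν.real (Set.Iio 0) = τ) (hf₀ : 0 < f₀) (hf : ∀ s, |s| ≤ h → f₀ ≤ f s) :
    ∫ s, linCoeff τ f f₀ θ h s ∂ν = 0 := by
  have h0 := weight_nonneg (h := h) hf₀ hf
  have h1 := weight_le_one (h := h) hf₀ hf
  have e : score τ = fun s => τ - (Set.Iio (0 : ℝ)).indicator 1 s := by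
    ext s
    simp [score, Set.indicator_apply]
  have i1 : Integrable ((Set.Iio (0 : ℝ)).indicator (1 : ℝ → ℝ)) ν :=
    (integrable_const (1 : ℝ)).indicator measurableSet_Iio
  have es : ∫ s, score τ s ∂ν = 0 := by
    rw [e, integral_sub (integrable_const _) i1, integral_indicator_one measurableSet_Iio, hq]
    simp
  have is : Integrable (score τ) ν := by
    rw [e]; exact (integrable_const _).sub i1
  have iw : Integrable (fun s => sgn s * weight f f₀ h s) ν :=
    integrable_of_abs_le (measurable_sgn.mul (measurable_weight hfm f₀ h)) (M := 1) fun s => by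
      rw [abs_mul, abs_sgn, one_mul, abs_of_nonneg (h0 s)]; exact h1 s
  have isn : Integrable (fun s => -score τ s) ν := is.neg
  unfold linCoeff
  rw [integral_add isn (iw.mul_const _), integral_neg, es, integral_mul_const,
    integral_mul_weight hfm hf0 hν hf₀ hf, integral_sgn_Ioo]
  simp

end weightMoments

/-! ### From coordinatewise moments to all directions. -/

section quadratic

variable {p : ℕ}

lemma abs_apply_le_norm (u : Vec p) (a : Fin p) : |u a| ≤ ‖u‖ := by
  simpa using PiLp.norm_apply_le u a

lemma inner_eq_sum (y u : Vec p) : inner ℝ y u = ∑ a, y a * u a := by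
  simp [PiLp.inner_apply, mul_comm]

/-- Control of the p² matrix entries controls the quadratic form on the whole ball, so finitely many
events serve all directions. -/
lemma sum_mul_inner_sq_ge (J : Finset ℕ) (y : ℕ → Vec p) (w : ℕ → ℝ) (u : Vec p) {r t : ℝ}
    (hu : ‖u‖ ≤ r) (ht : ∀ a b : Fin p, |∑ i ∈ J, w i * (y i a * y i b)| ≤ t) :
    -((p : ℝ) ^ 2 * t * r ^ 2) ≤ ∑ i ∈ J, w i * inner ℝ (y i) u ^ 2 := by
  have e : ∑ i ∈ J, w i * inner ℝ (y i) u ^ 2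
      = ∑ a, ∑ b, (∑ i ∈ J, w i * (y i a * y i b)) * (u a * u b) := by
    simp only [inner_eq_sum, sq, Finset.mul_sum, Finset.sum_mul]
    rw [Finset.sum_comm]
    refine Finset.sum_congr rfl fun a _ => ?_
    rw [Finset.sum_comm]
    exact Finset.sum_congr rfl fun b _ => Finset.sum_congr rfl fun i _ => by ring
  have hterm : ∀ a b : Fin p,
      -(t * r ^ 2) ≤ (∑ i ∈ J, w i * (y i a * y i b)) * (u a * u b) := by
    intro a b
    have h1 : |(∑ i ∈ J, w i * (y i a * y i b)) * (u a * u b)| ≤ t * (r * r) := by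
      rw [abs_mul, abs_mul]
      have ha := (abs_apply_le_norm u a).trans hu
      have hb := (abs_apply_le_norm u b).trans hu
      exact mul_le_mul (ht a b) (mul_le_mul ha hb (abs_nonneg _) ((abs_nonneg _).trans ha))
        (by positivity) ((abs_nonneg _).trans (ht a b))
    rw [sq]
    exact (abs_le.1 h1).1
  rw [e]
  have := Finset.sum_le_sum fun a (_ : a ∈ (Finset.univ : Finset (Fin p))) =>
    Finset.sum_le_sum fun b (_ : b ∈ (Finset.univ : Finset (Fin p))) => hterm a b
  simp only [Finset.sum_const, Finset.card_univ, Fintype.card_fin, nsmul_eq_mul] at this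
  linarith

lemma sum_mul_inner_ge (J : Finset ℕ) (y : ℕ → Vec p) (w : ℕ → ℝ) (u : Vec p) {r t : ℝ}
    (hu : ‖u‖ ≤ r) (ht : ∀ a : Fin p, |∑ i ∈ J, w i * y i a| ≤ t) :
    -(p * t * r) ≤ ∑ i ∈ J, w i * inner ℝ (y i) u := by
  have e : ∑ i ∈ J, w i * inner ℝ (y i) u = ∑ a, (∑ i ∈ J, w i * y i a) * u a := by
    simp only [inner_eq_sum, Finset.mul_sum, Finset.sum_mul]
    rw [Finset.sum_comm]
    exact Finset.sum_congr rfl fun a _ => Finset.sum_congr rfl fun i _ => by ring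
  have hterm : ∀ a : Fin p, -(t * r) ≤ (∑ i ∈ J, w i * y i a) * u a := by
    intro a
    have h1 : |(∑ i ∈ J, w i * y i a) * u a| ≤ t * r := by
      rw [abs_mul]
      exact mul_le_mul (ht a) ((abs_apply_le_norm u a).trans hu) (by positivity)
        ((abs_nonneg _).trans (ht a))
    exact (abs_le.1 h1).1
  rw [e]
  have := Finset.sum_le_sum fun a (_ : a ∈ (Finset.univ : Finset (Fin p))) => hterm a
  simp only [Finset.sum_const, Finset.card_univ, Fintype.card_fin, nsmul_eq_mul] at this
  linarith

end quadratic

/-! ### Growth of the loss on a sphere and beyond it. -/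

/-- On the sphere of radius `r`, the increment of the loss is bounded below by a quadratic term
minus a linear one, as soon as the empirical moments are close to their means. -/
lemma sum_checkLoss_sub_ge {p : ℕ} {τ f₀ θ r κ t m₀ ℓ : ℝ} {f : ℝ → ℝ} (J : Finset ℕ)
    (y : ℕ → Vec p) (e : ℕ → ℝ) (hr : 0 < r) (hθ0 : 0 ≤ θ)
    (hf₀ : 0 < f₀) (hf : ∀ s, |s| ≤ θ * r → f₀ ≤ f s) (hJ : (J.card : ℝ) = ℓ)
    (hy : ∀ i ∈ J, ‖y i‖ ≤ 1) (u : Vec p) (hu : ‖u‖ = r)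
    (hquad : m₀ * ℓ * ‖u‖ ^ 2 ≤ ∑ i ∈ J, inner ℝ (y i) u ^ 2)
    (h1 : ∀ a b : Fin p, |∑ i ∈ J, (weight f f₀ (θ * r) (e i) - f₀ * (2 * (θ * r))) *
      (y i a * y i b)| ≤ κ * r * ℓ)
    (h2 : |∑ i ∈ J, (weight f f₀ (θ * r) (e i) - f₀ * (2 * (θ * r))) * 1| ≤ κ * r * ℓ)
    (h3 : ∀ a : Fin p, |∑ i ∈ J, linCoeff τ f f₀ θ (θ * r) (e i) * y i a| ≤ t) :
    r ^ 2 * ℓ * (f₀ * θ * (m₀ - θ) - κ * (p ^ 2 + θ) / 2) - p * t * r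
      ≤ ∑ i ∈ J, (checkLoss τ (e i - inner ℝ (y i) u) - checkLoss τ (e i)) := by
  set k : ℕ → ℝ := fun i => weight f f₀ (θ * r) (e i) with hk
  set kb : ℝ := f₀ * (2 * (θ * r)) with hkb
  have hpt : ∀ i ∈ J, k i * ((inner ℝ (y i) u ^ 2 - θ * r ^ 2) / (2 * r))
      + linCoeff τ f f₀ θ (θ * r) (e i) * inner ℝ (y i) u
      ≤ checkLoss τ (e i - inner ℝ (y i) u) - checkLoss τ (e i) := by
    intro i hi
    refine checkLoss_sub_ge_weighted hr ?_ (weight_nonneg hf₀ hf _) (weight_le_one hf₀ hf _)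
      abs_lt_of_weight_ne_zero
    refine (abs_real_inner_le_norm _ _).trans ?_
    rw [hu]
    exact mul_le_of_le_one_left hr.le (hy i hi)
  refine le_trans ?_ (Finset.sum_le_sum hpt)
  rw [Finset.sum_add_distrib]
  have hlin := sum_mul_inner_ge J y (fun i => linCoeff τ f f₀ θ (θ * r) (e i)) u hu.le h3
  have hq := sum_mul_inner_sq_ge J y (fun i => k i - kb) u hu.le h1
  -- Each weight is split into its mean `kb` and a fluctuation. The means give the curvature; the
  -- fluctuations are bounded by `h1` and `h2`.
  have hid : ∑ i ∈ J, k i * ((inner ℝ (y i) u ^ 2 - θ * r ^ 2) / (2 * r))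
      = (∑ i ∈ J, (k i - kb) * inner ℝ (y i) u ^ 2 + kb * ∑ i ∈ J, inner ℝ (y i) u ^ 2
        - θ * r ^ 2 * (∑ i ∈ J, (k i - kb) * 1) - θ * r ^ 2 * (kb * ℓ)) / (2 * r) := by
    have hc : kb * ℓ = ∑ i ∈ J, kb := by rw [Finset.sum_const, nsmul_eq_mul, hJ, mul_comm]
    rw [hc, Finset.mul_sum, Finset.mul_sum, Finset.mul_sum, ← Finset.sum_add_distrib,
      ← Finset.sum_sub_distrib, ← Finset.sum_sub_distrib, Finset.sum_div]
    exact Finset.sum_congr rfl fun i _ => by ring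
  have hmain : r ^ 2 * ℓ * (f₀ * θ * (m₀ - θ) - κ * (p ^ 2 + θ) / 2)
      ≤ ∑ i ∈ J, k i * ((inner ℝ (y i) u ^ 2 - θ * r ^ 2) / (2 * r)) := by
    rw [hid, le_div_iff₀ (by positivity)]
    have hkb0 : 0 ≤ kb := by positivity
    have h4 := mul_le_mul_of_nonneg_left hquad hkb0
    have h5 := mul_le_mul_of_nonneg_left (abs_le.1 h2).2 (by positivity : 0 ≤ θ * r ^ 2)
    rw [hu] at h4
    have hexp : r ^ 2 * ℓ * (f₀ * θ * (m₀ - θ) - κ * (p ^ 2 + θ) / 2) * (2 * r)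
        = kb * (m₀ * ℓ * r ^ 2) - θ * r ^ 2 * (kb * ℓ) - p ^ 2 * (κ * r * ℓ) * r ^ 2
          - θ * r ^ 2 * (κ * r * ℓ) := by
      rw [hkb]; ring
    rw [hexp]
    linarith
  linarith

/-- Increments of a sum of check losses grow at least linearly along rays. -/
lemma lt_sum_checkLoss_sub_of_sphere {p : ℕ} {τ r Λ : ℝ} (J : Finset ℕ) (y : ℕ → Vec p)
    (e : ℕ → ℝ) (hr : 0 < r)
    (h : ∀ u : Vec p, ‖u‖ = r →
      Λ * r < ∑ i ∈ J, (checkLoss τ (e i - inner ℝ (y i) u) - checkLoss τ (e i)))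
    (u : Vec p) (hu : r < ‖u‖) :
    Λ * ‖u‖ < ∑ i ∈ J, (checkLoss τ (e i - inner ℝ (y i) u) - checkLoss τ (e i)) := by
  have hu0 : 0 < ‖u‖ := hr.trans hu
  set t := r / ‖u‖ with ht
  have ht0 : 0 < t := by positivity
  have ht1 : t ≤ 1 := div_le_one_of_le₀ hu.le hu0.le
  have hn : ‖t • u‖ = r := by
    rw [norm_smul, Real.norm_of_nonneg ht0.le, ht, div_mul_cancel₀ _ hu0.ne']
  have h1 := h (t • u) hn
  have h2 : ∑ i ∈ J, (checkLoss τ (e i - inner ℝ (y i) (t • u)) - checkLoss τ (e i))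
      ≤ t * ∑ i ∈ J, (checkLoss τ (e i - inner ℝ (y i) u) - checkLoss τ (e i)) := by
    rw [Finset.mul_sum]
    refine Finset.sum_le_sum fun i _ => ?_
    rw [inner_smul_right]
    exact checkLoss_sub_smul_le τ _ _ ht0.le ht1
  have h3 : Λ * r = t * (Λ * ‖u‖) := by
    rw [ht]; field_simp
  rw [h3] at h1
  exact lt_of_mul_lt_mul_left (h1.trans_le h2) ht0.le

/-! ### High-probability growth on a block. -/

section event

variable {Ω : Type*} [MeasurableSpace Ω] {P : Measure Ω} [IsProbabilityMeasure P]
  {τ : ℝ} {ε : ℕ → Ω → ℝ} {ν : Measure ℝ} {f : ℝ → ℝ}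

/-- The empirical moments on a block are close to their means with high probability. -/
lemma IsNoise.exists_moment_event (hn : IsNoise P ε ν f τ) (hτ : τ ∈ Set.Ioo (0 : ℝ) 1)
    {p : ℕ} {f₀ θ r κ t : ℝ} (hf₀ : 0 < f₀) (hθ0 : 0 ≤ θ) (hθ1 : θ ≤ 1) (hr : 0 < r)
    (hκ : 0 < κ) (ht : 0 < t)
    (hf : ∀ s, |s| ≤ θ * r → f₀ ≤ f s) (J : Finset ℕ) (hJ : ∀ i ∈ J, 1 ≤ i) (hne : J.Nonempty)
    (y : ℕ → Vec p) (hy : ∀ i ∈ J, ‖y i‖ ≤ 1) :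
    ∃ N : Set Ω, P.real N ≤ (p ^ 2 + 1) * (2 * f₀ * θ / (κ ^ 2 * (r * J.card)))
        + p * (4 * J.card / t ^ 2) ∧
      ∀ ω ∉ N,
        (∀ a b : Fin p, |∑ i ∈ J, (weight f f₀ (θ * r) (ε i ω) - f₀ * (2 * (θ * r))) *
          (y i a * y i b)| ≤ κ * r * J.card) ∧
        |∑ i ∈ J, (weight f f₀ (θ * r) (ε i ω) - f₀ * (2 * (θ * r))) * 1| ≤ κ * r * J.card ∧
        (∀ a : Fin p, |∑ i ∈ J, linCoeff τ f f₀ θ (θ * r) (ε i ω) * y i a| ≤ t) := by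
  have hprob : IsProbabilityMeasure ν := by
    rw [← hn.law 1 le_rfl]
    exact Measure.isProbabilityMeasure_map (hn.measurable 1 le_rfl).aemeasurable
  have hh : 0 ≤ θ * r := by positivity
  have hℓ : (0 : ℝ) < J.card := by exact_mod_cast hne.card_pos
  have hw0 := weight_nonneg hf₀ hf
  have hw1 := weight_le_one hf₀ hf
  have hya : ∀ i ∈ J, ∀ a, |y i a| ≤ 1 := fun i hi a => (abs_apply_le_norm _ a).trans (hy i hi)
  set W : (ℕ → ℝ) → Set Ω := fun c =>
    {ω | κ * r * J.card ≤ |∑ i ∈ J, (weight f f₀ (θ * r) (ε i ω) - f₀ * (2 * (θ * r))) * c i|}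
    with hW
  set B : Fin p → Set Ω := fun a =>
    {ω | t ≤ |∑ i ∈ J, (linCoeff τ f f₀ θ (θ * r) (ε i ω) - 0) * y i a|} with hB
  have hWle : ∀ c : ℕ → ℝ, (∀ i ∈ J, |c i| ≤ 1) →
      P.real (W c) ≤ 2 * f₀ * θ / (κ ^ 2 * (r * J.card)) := by
    intro c hc
    refine (hn.measureReal_abs_sum_ge_le (measurable_weight hn.density_measurable f₀ (θ * r))
      (M := 1) (fun s => ?_) (integral_weight hn.density_measurable hn.density_nonneg hn.density
      hf₀ hh hf) (integral_sq_weight_le hn.density_measurable hn.density_nonneg hn.density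
      hf₀ hh hf) (by positivity) J hJ c hc).trans (le_of_eq ?_)
    · rw [abs_of_nonneg (hw0 s)]; exact hw1 s
    · field_simp
  have hBle : ∀ a, P.real (B a) ≤ 4 * J.card / t ^ 2 := by
    intro a
    refine (hn.measureReal_abs_sum_ge_le (V := 4) (measurable_linCoeff hn.density_measurable τ f₀ θ
      (θ * r)) (abs_linCoeff_le hτ hθ0 hθ1 hf₀ hf) (integral_linCoeff hn.density_measurable
      hn.density_nonneg hn.density hn.quantile hf₀ hf) ?_ ht J hJ (fun i => y i a)
      fun i hi => hya i hi a).trans (le_of_eq (by ring))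
    have : ∫ s, linCoeff τ f f₀ θ (θ * r) s ^ 2 ∂ν ≤ ∫ _, (4 : ℝ) ∂ν := by
      have hb : ∀ s, linCoeff τ f f₀ θ (θ * r) s ^ 2 ≤ 4 := fun s => by
        rw [← sq_abs]
        nlinarith [abs_linCoeff_le hτ hθ0 hθ1 hf₀ hf s, abs_nonneg (linCoeff τ f f₀ θ (θ * r) s)]
      refine integral_mono (integrable_of_abs_le ((measurable_linCoeff hn.density_measurable τ f₀ θ
        (θ * r)).pow_const 2) (M := 4) fun s => ?_) (integrable_const _) hb
      rw [abs_of_nonneg (sq_nonneg _)]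
      exact hb s
    simpa using this
  refine ⟨((⋃ q : Fin p × Fin p, W fun i => y i q.1 * y i q.2) ∪ W fun _ => 1) ∪ ⋃ a, B a, ?_, ?_⟩
  · refine (measureReal_union_le _ _).trans (add_le_add ?_ ?_)
    · refine (measureReal_union_le _ _).trans ?_
      have h1 := (measureReal_iUnion_fintype_le (μ := P)
        (fun q : Fin p × Fin p => W fun i => y i q.1 * y i q.2)).trans
        (Finset.sum_le_card_nsmul _ _ _ fun q _ => hWle (fun i => y i q.1 * y i q.2) fun i hi => by
          rw [abs_mul]
          exact mul_le_one₀ (hya i hi _) (abs_nonneg _) (hya i hi _))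
      have h2 := hWle (fun _ => 1) (by simp)
      simp only [Finset.card_univ, Fintype.card_prod, Fintype.card_fin, nsmul_eq_mul,
        Nat.cast_mul] at h1
      nlinarith
    · have h1 := (measureReal_iUnion_fintype_le (μ := P) B).trans
        (Finset.sum_le_card_nsmul _ _ _ fun a _ => hBle a)
      simpa using h1
  · intro ω hω
    simp only [Set.mem_union, Set.mem_iUnion, not_or, not_exists] at hω
    obtain ⟨⟨h1, h2⟩, h3⟩ := hω
    refine ⟨fun a b => (not_le.1 (h1 (a, b))).le, (not_le.1 h2).le, fun a => ?_⟩
    have : |∑ i ∈ J, (linCoeff τ f f₀ θ (θ * r) (ε i ω) - 0) * y i a| ≤ t :=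
      (lt_of_not_ge fun hc => h3 a hc).le
    simpa only [sub_zero] using this

/-- With high probability, on a long block of observations the loss increases faster than the
penalty outside a ball of radius `C (Λ / ℓ + ℓ^{-1/2})`, `ℓ` being the length of the block. -/
theorem IsNoise.exists_growth_event (hn : IsNoise P ε ν f τ) (hτ : τ ∈ Set.Ioo (0 : ℝ) 1)
    (hpos : PositiveNearZero f) (p : ℕ) {m₀ : ℝ} (hm₀ : 0 < m₀) {η : ℝ} (hη : 0 < η) :
    ∃ C > 0, ∃ r₀ > 0, ∃ L₀ > 0, ∀ (J : Finset ℕ) (y : ℕ → Vec p) (Λ : ℝ), 0 < Λ →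
      (∀ i ∈ J, 1 ≤ i) → (∀ i ∈ J, ‖y i‖ ≤ 1) → L₀ ≤ (J.card : ℝ) →
      (∀ u : Vec p, m₀ * J.card * ‖u‖ ^ 2 ≤ ∑ i ∈ J, inner ℝ (y i) u ^ 2) →
      C * (Λ / J.card + (√(J.card : ℝ))⁻¹) ≤ r₀ →
      ∃ N : Set Ω, P.real N ≤ η ∧ ∀ ω ∉ N, ∀ u : Vec p,
        C * (Λ / J.card + (√(J.card : ℝ))⁻¹) < ‖u‖ →
        2 * Λ * ‖u‖ < ∑ i ∈ J, (checkLoss τ (ε i ω - inner ℝ (y i) u) - checkLoss τ (ε i ω)) := by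
  obtain ⟨f₀, hf₀, η₀, hη₀, hf⟩ := hpos
  set θ : ℝ := min (m₀ / 2) 1 with hθ
  -- The curvature per observation is f₀θ(m₀ - θ)r², so θ must stay below m₀. The constant κ below
  -- lets fluctuations consume half of it, leaving c.
  have hθ0 : 0 < θ := by positivity
  have hθ1 : θ ≤ 1 := min_le_right _ _
  have hθm : θ ≤ m₀ / 2 := min_le_left _ _
  set c : ℝ := f₀ * θ * (m₀ - θ) / 2 with hc
  have hc0 : 0 < c := by
    have : 0 < m₀ - θ := by linarith
    positivity
  set κ : ℝ := 2 * c / (p ^ 2 + θ) with hκ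
  have hκ0 : 0 < κ := by positivity
  have hκc : f₀ * θ * (m₀ - θ) - κ * (p ^ 2 + θ) / 2 = c := by
    rw [hκ, div_mul_cancel₀ _ (by positivity)]; rw [hc]; ring
  set t : ℝ := √(8 * (p + 1) / η) with ht
  have ht0 : 0 < t := by positivity
  have ht2 : t ^ 2 = 8 * (p + 1) / η := Real.sq_sqrt (by positivity)
  -- With this C, the curvature r²ℓc = r·cC(Λ + √ℓ) beats both the target 2Λr and the linear term
  -- p·t·√ℓ·r.
  set C : ℝ := (2 + p * t + 1) / c with hC
  have hC0 : 0 < C := by positivity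
  have hCc : c * C = 2 + p * t + 1 := by rw [hC]; field_simp
  -- Once √ℓ ≥ s₀, the weight events have total probability at most η/2, because rℓ ≥ C√ℓ. The
  -- choice of t does the same for the linear events.
  set s₀ : ℝ := (p ^ 2 + 1) * (4 * f₀ * θ) / (κ ^ 2 * C * η) with hs₀
  have hs₀0 : 0 < s₀ := by positivity
  refine ⟨C, hC0, η₀, hη₀, s₀ ^ 2, by positivity, ?_⟩
  intro J y Λ hΛ hJ hy hL hquad hr₀
  have hℓ : (0 : ℝ) < J.card := lt_of_lt_of_le (by positivity) hL
  set ℓ : ℝ := (J.card : ℝ) with hℓdef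
  set q : ℝ := √ℓ with hq
  have hq0 : 0 < q := by positivity
  have hq2 : q ^ 2 = ℓ := Real.sq_sqrt hℓ.le
  have hsq : s₀ ≤ q := Real.le_sqrt_of_sq_le hL
  set r : ℝ := C * (Λ / ℓ + q⁻¹) with hr
  have hrpos : 0 < r := by positivity
  have hrℓ : r * ℓ = C * (Λ + q) := by
    rw [hr, ← hq2]; field_simp
  have hne : J.Nonempty := Finset.card_pos.1 (Nat.cast_pos.1 (hℓdef ▸ hℓ))
  have hf' : ∀ s, |s| ≤ θ * r → f₀ ≤ f s := fun s hs =>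
    hf s (hs.trans ((mul_le_of_le_one_left hrpos.le hθ1).trans hr₀))
  obtain ⟨N, hN, hgood⟩ := hn.exists_moment_event hτ hf₀ hθ0.le hθ1 hrpos hκ0
    (t := t * q) (by positivity) hf' J hJ hne y hy
  refine ⟨N, hN.trans ?_, fun ω hω => ?_⟩
  · rw [← hℓdef, hrℓ]
    have h1 : (p ^ 2 + 1) * (2 * f₀ * θ / (κ ^ 2 * (C * (Λ + q)))) ≤ η / 2 := by
      have h3 : (p ^ 2 + 1) * (4 * f₀ * θ) ≤ q * (κ ^ 2 * C * η) := by
        rw [← div_le_iff₀ (by positivity)]; exact hsq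
      have h4 : 0 < κ ^ 2 * C * η * Λ := by positivity
      rw [← mul_div_assoc, div_le_iff₀ (by positivity)]
      nlinarith
    have h2 : p * (4 * ℓ / (t * q) ^ 2) ≤ η / 2 := by
      rw [mul_pow, hq2, ht2]
      have : (p : ℝ) * (4 * ℓ / (8 * (p + 1) / η * ℓ)) = η / 2 * (p / (p + 1)) := by
        field_simp; ring
      rw [this]
      exact mul_le_of_le_one_right (by positivity)
        (div_le_one_of_le₀ (by linarith) (by positivity))
    linarith
  · obtain ⟨h1, h2, h3⟩ := hgood ω hω
    refine lt_sum_checkLoss_sub_of_sphere J y _ hrpos fun u hu => ?_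
    refine lt_of_lt_of_le ?_ (sum_checkLoss_sub_ge J y (fun i => ε i ω) hrpos hθ0.le hf₀ hf'
      hℓdef.symm hy u hu (hquad u) h1 h2 h3)
    rw [hκc]
    have h4 : r ^ 2 * ℓ * c = r * ((c * C) * (Λ + q)) := by
      rw [mul_assoc c C, ← hrℓ]; ring
    rw [h4, hCc]
    have h5 : 2 * Λ + p * (t * q) < (2 + p * t + 1) * (Λ + q) := by
      have h6 : 0 ≤ p * t * Λ := by positivity
      have h7 : (2 + p * t + 1) * (Λ + q)
          = 2 * Λ + p * (t * q) + (p * t * Λ + Λ + 3 * q) := by ring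
      linarith
    have h6 := mul_lt_mul_of_pos_left h5 hrpos
    rw [mul_add] at h6
    rw [mul_comm (2 * Λ) r, mul_comm _ r]
    linarith

end event

/-! ### Change-points, phases and windows. -/

section combinatorics

variable {p n : ℕ} {β : ℕ → Vec p}

lemma mem_changePoints {i : ℕ} :
    i ∈ changePoints n β ↔ (2 ≤ i ∧ i ≤ n) ∧ β i ≠ β (i - 1) := by
  simp [changePoints]

lemma eq_of_no_changePoint {a b : ℕ} (ha : 1 ≤ a) (hb : b ≤ n + 1)
    (h : ∀ i, a < i → i < b → i ∉ changePoints n β) {i : ℕ} (hai : a ≤ i) (hib : i < b) :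
    β i = β a := by
  induction i, hai using Nat.le_induction with
  | base => rfl
  | succ i hai ih =>
    rw [← ih (by omega)]
    by_contra hne
    exact h (i + 1) (by omega) hib (mem_changePoints.2 ⟨⟨by omega, by omega⟩, hne⟩)

lemma finite_changePoints : (Set.ofPred fun i => i ∈ changePoints n β).Finite :=
  (changePoints n β).finite_toSet

lemma card_finite_changePoints (hf : (Set.ofPred fun i => i ∈ changePoints n β).Finite) :
    hf.toFinset.card = (changePoints n β).card := by
  congr 1
  ext i
  simp

lemma location_zero : location n β 0 = 1 := rfl

lemma location_of_card_lt {k : ℕ} (hk : (changePoints n β).card < k) : location n β k = n := by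
  unfold location
  rw [if_neg (by omega), if_neg (by omega)]

lemma location_eq_nth {k : ℕ} (h1 : 1 ≤ k) (hk : k ≤ (changePoints n β).card) :
    location n β k = Nat.nth (fun i => i ∈ changePoints n β) (k - 1) := by
  unfold location
  rw [if_neg (by omega), if_pos hk]

lemma location_mem {k : ℕ} (h1 : 1 ≤ k) (hk : k ≤ (changePoints n β).card) :
    location n β k ∈ changePoints n β := by
  rw [location_eq_nth h1 hk]
  refine Nat.nth_mem_of_lt_card finite_changePoints ?_
  rw [card_finite_changePoints]
  omega

lemma location_lt {k l : ℕ} (h : k < l) (hl : l ≤ (changePoints n β).card) :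
    location n β k < location n β l := by
  rcases Nat.eq_zero_or_pos k with rfl | hk
  · have := (mem_changePoints.1 (location_mem (by omega) hl)).1.1
    rw [location_zero]; omega
  · rw [location_eq_nth hk (by omega), location_eq_nth (by omega) hl]
    refine Nat.nth_lt_nth' (by omega) fun hf => ?_
    rw [card_finite_changePoints]
    omega

lemma exists_location_eq {i : ℕ} (hi : i ∈ changePoints n β) :
    ∃ k, 1 ≤ k ∧ k ≤ (changePoints n β).card ∧ location n β k = i := by
  obtain ⟨k, hk, rfl⟩ := Nat.exists_lt_card_finite_nth_eq finite_changePoints hi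
  rw [card_finite_changePoints] at hk
  exact ⟨k + 1, by omega, by omega, location_eq_nth (by omega) (by omega)⟩

lemma one_le_location (hn : 1 ≤ n) (k : ℕ) : 1 ≤ location n β k := by
  rcases Nat.eq_zero_or_pos k with rfl | hk
  · exact le_rfl
  · rcases le_or_gt k (changePoints n β).card with h | h
    · have := (mem_changePoints.1 (location_mem hk h)).1.1
      omega
    · rw [location_of_card_lt h]; exact hn

lemma location_le (hn : 1 ≤ n) (k : ℕ) : location n β k ≤ n := by
  rcases Nat.eq_zero_or_pos k with rfl | hk
  · exact hn
  · rcases le_or_gt k (changePoints n β).card with h | h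
    · exact (mem_changePoints.1 (location_mem hk h)).1.2
    · exact (location_of_card_lt h).le

lemma eq_phase (hn : 1 ≤ n) {k i : ℕ} (hk1 : 1 ≤ k) (hk : k ≤ (changePoints n β).card + 1)
    (h1 : location n β (k - 1) ≤ i) (h2 : i < location n β k) : β i = phase n β k := by
  refine eq_of_no_changePoint (n := n) (one_le_location hn _)
    ((location_le hn k).trans (Nat.le_succ n)) (fun j hj1 hj2 hj => ?_) h1 h2
  obtain ⟨l, hl1, hl, rfl⟩ := exists_location_eq hj
  rcases lt_or_ge l k with hlk | hlk
  · rcases eq_or_lt_of_le (Nat.le_sub_one_of_lt hlk) with he | he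
    · exact absurd hj1 (by rw [he]; exact lt_irrefl _)
    · exact absurd hj1 (location_lt he (by omega)).le.not_gt
  · rcases eq_or_lt_of_le hlk with he | he
    · exact absurd hj2 (by rw [he]; exact lt_irrefl _)
    · exact absurd hj2 (location_lt he hl).le.not_gt

/-- If the number of change-points equals the number of disjoint windows, each of which contains a
change-point, then the `k`-th change-point lies in the `k`-th window. -/
lemma location_mem_window {K L : ℕ} {T : ℕ → ℕ} (hcard : (changePoints n β).card = K)
    (hT : ∀ k ≤ K, T k + 2 * L ≤ T (k + 1))
    (hex : ∀ k, 1 ≤ k → k ≤ K → ∃ i ∈ changePoints n β, T k < i + L ∧ i < T k + L)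
    {k : ℕ} (hk1 : 1 ≤ k) (hk : k ≤ K) :
    T k < location n β k + L ∧ location n β k < T k + L := by
  have hTmono : ∀ l k, k < l → l ≤ K → T k + 2 * L ≤ T l := by
    intro l
    induction l with
    | zero => intro k hk; omega
    | succ l ih =>
      intro k hk hl
      have h1 := hT l (by omega)
      rcases eq_or_lt_of_le (Nat.lt_succ_iff.1 hk) with rfl | h
      · exact h1
      · have := ih k h (by omega)
        omega
  have hex' : ∀ k, 1 ≤ k → k ≤ K → ∃ j, 1 ≤ j ∧ j ≤ K ∧
      T k < location n β j + L ∧ location n β j < T k + L := by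
    intro k h1 h2
    obtain ⟨i, hi, hi1, hi2⟩ := hex k h1 h2
    obtain ⟨j, hj1, hj2, rfl⟩ := exists_location_eq hi
    exact ⟨j, hj1, hcard ▸ hj2, hi1, hi2⟩
  -- The windows are disjoint and ordered, so j is strictly increasing from {1, …, K} to itself,
  -- hence the identity.
  choose! j hj1 hjK hjl hju using hex'
  have hmono : ∀ k l, 1 ≤ k → k < l → l ≤ K → j k < j l := by
    intro k l h1 hkl hl
    by_contra hc
    have h2 := hju k h1 (by omega)
    have h3 := hjl l (by omega) hl
    have h4 := hTmono l k hkl hl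
    have h5 : location n β (j l) ≤ location n β (j k) := by
      rcases eq_or_lt_of_le (not_lt.1 hc) with h | h
      · rw [h]
      · exact (location_lt h (hcard ▸ hjK k h1 (by omega))).le
    omega
  have hlow : ∀ k, 1 ≤ k → k ≤ K → k ≤ j k := by
    intro k h1
    induction k, h1 using Nat.le_induction with
    | base => exact fun h => hj1 1 le_rfl h
    | succ k h1 ih =>
      intro h
      have := ih (by omega)
      have := hmono k (k + 1) h1 (by omega) h
      omega
  have hup : ∀ d k, 1 ≤ k → k + d = K → j k ≤ k := by
    intro d
    induction d with
    | zero => intro k h1 h; have := hjK k h1 (by omega); omega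
    | succ d ih =>
      intro k h1 h
      have := ih (k + 1) (by omega) (by omega)
      have := hmono k (k + 1) h1 (by omega) (by omega)
      omega
  have hjk : j k = k := le_antisymm (hup (K - k) k hk1 (by omega)) (hlow k hk1 hk)
  have h1 := hjl k hk1 hk
  have h2 := hju k hk1 hk
  rw [hjk] at h1 h2
  exact ⟨h1, h2⟩

/-- If `β` is close to `β'` on every block on both sides of the change-points of `β'` on which it
is constant, and has as many change-points as `β'`, then its `k`-th phase covers the interior of
the `k`-th phase of `β'`. -/
lemma eq_phase_of_close {β' : ℕ → Vec p} {K L : ℕ} {D b : ℝ} (hn : 1 ≤ n)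
    (hcard : (changePoints n β).card = K) (hcard' : (changePoints n β').card = K) (hL : 1 ≤ L)
    (hT : ∀ k ≤ K, location n β' k + 4 * L ≤ location n β' (k + 1))
    (hjump : ∀ k ∈ Finset.Icc 1 K, b < ‖phase n β' (k + 1) - phase n β' k‖) (hD : 2 * D ≤ b)
    (hleft : ∀ k ∈ Finset.Icc 1 K, ∀ v φ : Vec p,
      (∀ i ∈ Finset.Ico (location n β' k - L) (location n β' k), β i = v) →
      (∀ i ∈ Finset.Ico (location n β' k - L) (location n β' k), β' i = φ) → ‖v - φ‖ ≤ D)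
    (hright : ∀ k ∈ Finset.Icc 1 K, ∀ v φ : Vec p,
      (∀ i ∈ Finset.Ico (location n β' k) (location n β' k + L), β i = v) →
      (∀ i ∈ Finset.Ico (location n β' k) (location n β' k + L), β' i = φ) → ‖v - φ‖ ≤ D)
    {k : ℕ} (hk1 : 1 ≤ k) (hk : k ≤ K + 1) {i : ℕ} (hi1 : location n β' (k - 1) + L ≤ i)
    (hi2 : i + L < location n β' k) : β i = phase n β k := by
  have hwin := fun {k : ℕ} => location_mem_window (β := β) (L := L) (T := location n β') hcard
    (fun k hk => by have := hT k hk; omega) (k := k) (by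
    intro k h1 h2
    -- Without a change-point strictly between `T - L` and `T + L`, β is constant on `[T - L, T +
    -- L)`, hence within D of both neighbouring coefficients, against a jump larger than 2D.
    by_contra! hc
    have hs1 := hT k h2
    have hs2 := hT (k - 1) (by omega)
    rw [Nat.sub_add_cancel h1] at hs2
    have hle := location_le (β := β') hn (k + 1)
    have h1' := one_le_location (β := β') hn (k - 1)
    have hconst : ∀ i, location n β' k - L ≤ i → i < location n β' k + L →
        β i = β (location n β' k - L) := fun i =>
      eq_of_no_changePoint (n := n) (by omega) (by omega) fun i hi1 hi2 hi => by
        have := hc i hi (by omega)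
        omega
    have e1 := hleft k (Finset.mem_Icc.2 ⟨h1, h2⟩) (β (location n β' k - L)) (phase n β' k)
      (fun i hi => by
        rw [Finset.mem_Ico] at hi
        exact hconst i hi.1 (by omega))
      (fun i hi => by
        rw [Finset.mem_Ico] at hi
        exact eq_phase hn h1 (by omega) (by omega) hi.2)
    have e2 := hright k (Finset.mem_Icc.2 ⟨h1, h2⟩) (β (location n β' k - L)) (phase n β' (k + 1))
      (fun i hi => by
        rw [Finset.mem_Ico] at hi
        exact hconst i (by omega) hi.2)
      (fun i hi => by
        rw [Finset.mem_Ico] at hi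
        exact eq_phase hn (by omega) (by omega) (by simpa using hi.1) (by omega))
    have e3 := hjump k (Finset.mem_Icc.2 ⟨h1, h2⟩)
    have e4 := norm_sub_le_norm_sub_add_norm_sub (phase n β' (k + 1)) (β (location n β' k - L))
      (phase n β' k)
    rw [norm_sub_rev] at e2
    linarith)
  refine eq_phase hn hk1 (by omega) ?_ ?_
  · rcases Nat.eq_zero_or_pos (k - 1) with h | h
    · rw [h, location_zero] at hi1 ⊢
      omega
    · have := (hwin h (by omega)).2
      omega
  · rcases Nat.lt_or_ge K k with h | h
    · rw [location_of_card_lt (by omega)] at hi2 ⊢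
      omega
    · have := (hwin hk1 h).1
      omega

end combinatorics

/-! ### Comparing a minimizer with its modification on a block. -/

section modification

variable {p : ℕ}

/-- Replacing the value of a minimizer on a block on which it is constant. -/
lemma IsFusedEstimator.sum_checkLoss_sub_le {τ lam : ℝ} {n : ℕ} {x : ℕ → Vec p} {y : ℕ → ℝ}
    {β : ℕ → Vec p} (hβ : IsFusedEstimator τ lam n x y β) (hlam : 0 ≤ lam) {a b : ℕ}
    (ha : 1 ≤ a) (hb : b ≤ n + 1) {v : Vec p} (hv : ∀ i ∈ Finset.Ico a b, β i = v) (w : Vec p) :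
    ∑ i ∈ Finset.Ico a b, (checkLoss τ (y i - inner ℝ (x i) v)
      - checkLoss τ (y i - inner ℝ (x i) w)) ≤ 2 * (n * lam) * ‖v - w‖ := by
  set γ : ℕ → Vec p := fun i => if i ∈ Finset.Ico a b then w else β i with hγ
  have hopt := hβ γ
  unfold objective at hopt
  have hloss : ∑ i ∈ Finset.Ico a b, (checkLoss τ (y i - inner ℝ (x i) v)
      - checkLoss τ (y i - inner ℝ (x i) w))
      = ∑ i ∈ Finset.Icc 1 n, checkLoss τ (y i - inner ℝ (x i) (β i))
        - ∑ i ∈ Finset.Icc 1 n, checkLoss τ (y i - inner ℝ (x i) (γ i)) := by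
    rw [← Finset.sum_sub_distrib]
    have hsub : Finset.Ico a b ⊆ Finset.Icc 1 n := fun i hi => by
      rw [Finset.mem_Ico] at hi
      exact Finset.mem_Icc.2 ⟨by omega, by omega⟩
    rw [← Finset.sum_subset hsub]
    · exact Finset.sum_congr rfl fun i hi => by simp only [hγ, if_pos hi, hv i hi]
    · intro i _ hi
      simp only [hγ, if_neg hi, sub_self]
  have hpen : ∑ i ∈ Finset.Icc 2 n, ‖γ i - γ (i - 1)‖
      ≤ ∑ i ∈ Finset.Icc 2 n, ‖β i - β (i - 1)‖ + 2 * ‖v - w‖ := by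
    -- Only the increments at the ends `a` and `b` can grow, each by at most ‖v - w‖.
    have hpt : ∀ i ∈ Finset.Icc 2 n, ‖γ i - γ (i - 1)‖ ≤ ‖β i - β (i - 1)‖
        + ((if i = a then ‖v - w‖ else 0) + if i = b then ‖v - w‖ else 0) := by
      intro i hi
      rw [Finset.mem_Icc] at hi
      have hva : 0 ≤ if i = a then ‖v - w‖ else 0 := by split_ifs <;> positivity
      have hvb : 0 ≤ if i = b then ‖v - w‖ else 0 := by split_ifs <;> positivity
      by_cases h1 : i ∈ Finset.Ico a b <;> by_cases h2 : i - 1 ∈ Finset.Ico a b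
      · simp only [hγ, if_pos h1, if_pos h2, sub_self, norm_zero]
        positivity
      · have : i = a := by
          rw [Finset.mem_Ico] at h1 h2
          omega
        have h3 := norm_sub_le_norm_sub_add_norm_sub w (β i) (β (i - 1))
        rw [hv i h1, norm_sub_rev w v] at h3
        simp only [hγ, if_pos h1, if_neg h2, if_pos this, hv i h1]
        linarith
      · have : i = b := by
          rw [Finset.mem_Ico] at h1 h2
          omega
        have h3 := norm_sub_le_norm_sub_add_norm_sub (β i) (β (i - 1)) w
        rw [hv _ h2] at h3
        simp only [hγ, if_neg h1, if_pos h2, if_pos this, hv _ h2]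
        rw [if_pos this] at hvb
        linarith
      · simp only [hγ, if_neg h1, if_neg h2]
        linarith
    refine (Finset.sum_le_sum hpt).trans ?_
    rw [Finset.sum_add_distrib, Finset.sum_add_distrib, Finset.sum_ite_eq', Finset.sum_ite_eq']
    have h1 : (if a ∈ Finset.Icc 2 n then ‖v - w‖ else 0) ≤ ‖v - w‖ := by
      split_ifs <;> simp
    have h2 : (if b ∈ Finset.Icc 2 n then ‖v - w‖ else 0) ≤ ‖v - w‖ := by
      split_ifs <;> simp
    linarith
  have h3 := mul_le_mul_of_nonneg_left hpen (by positivity : 0 ≤ (n : ℝ) * lam)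
  rw [hloss]
  linarith

end modification

/-! ### Curvature from the eigenvalues of the design. -/

section design

variable {p : ℕ}

lemma designMatrix_isHermitian (x : ℕ → Vec p) (a b : ℕ) : (designMatrix x a b).IsHermitian := by
  ext i j
  simp [designMatrix, Matrix.sum_apply, mul_comm]

lemma sum_inner_sq_ge_of_spectrum {x : ℕ → Vec p} {a b : ℕ} {m₀ M₀ : ℝ} (hab : a < b)
    (h : spectrum ℝ (designMatrix x a b) ⊆ Set.Icc m₀ M₀) (u : Vec p) :
    m₀ * ((b : ℝ) - a) * ‖u‖ ^ 2 ≤ ∑ i ∈ Finset.Ico a b, inner ℝ (x i) u ^ 2 := by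
  have hpos : (0 : ℝ) < (b : ℝ) - a := by
    have : (a : ℝ) < b := by exact_mod_cast hab
    linarith
  have hA := designMatrix_isHermitian x a b
  -- Subtracting m₀ times the identity shifts the spectrum to the nonnegative half-line.
  have hps : (designMatrix x a b - algebraMap ℝ _ m₀).PosSemidef := by
    rw [Matrix.posSemidef_iff_isHermitian_and_spectrum_nonneg]
    refine ⟨hA.sub ?_, ?_⟩
    · rw [Matrix.algebraMap_eq_diagonal]
      exact Matrix.isHermitian_diagonal _
    · rw [← spectrum.sub_singleton_eq]
      rintro _ ⟨s, hs, _, rfl, rfl⟩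
      have := (h hs).1
      simp only [Set.mem_ofPred_eq, sub_nonneg]
      exact this
  have h1 := hps.dotProduct_mulVec_nonneg u.ofLp
  rw [Matrix.sub_mulVec, dotProduct_sub, sub_nonneg] at h1
  have e1 : star u.ofLp ⬝ᵥ (algebraMap ℝ (Matrix (Fin p) (Fin p) ℝ) m₀).mulVec u.ofLp
      = m₀ * ‖u‖ ^ 2 := by
    rw [Algebra.algebraMap_eq_smul_one, Matrix.smul_mulVec, Matrix.one_mulVec,
      dotProduct_smul, EuclideanSpace.real_norm_sq_eq]
    simp [dotProduct, sq]
  have e2 : star u.ofLp ⬝ᵥ (designMatrix x a b).mulVec u.ofLp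
      = ((b : ℝ) - a)⁻¹ * ∑ i ∈ Finset.Ico a b, inner ℝ (x i) u ^ 2 := by
    unfold designMatrix
    rw [Matrix.smul_mulVec, dotProduct_smul, smul_eq_mul, Matrix.sum_mulVec, dotProduct_sum]
    congr 1
    refine Finset.sum_congr rfl fun i _ => ?_
    simp only [dotProduct, Matrix.mulVec, Matrix.of_apply, inner_eq_sum, sq, Finset.sum_mul,
      Finset.mul_sum, star_trivial]
    exact Finset.sum_congr rfl fun a _ => Finset.sum_congr rfl fun b _ => by ring
  rw [e1, e2, ← div_eq_inv_mul, le_div_iff₀ hpos] at h1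
  linarith

end design

/-! ### Localization of the minimizer, block rates and the theorem. -/

lemma le_minDist_iff {p K n : ℕ} {β : ℕ → Vec p} {c : ℝ} :
    c ≤ minDist K n β ↔ ∀ k ≤ K, (location n β k : ℝ) + c ≤ location n β (k + 1) := by
  unfold minDist
  rw [Finset.le_inf'_iff]
  constructor
  · intro h k hk
    have := h (k + 1) (Finset.mem_Icc.2 ⟨by omega, by omega⟩)
    simp only [Nat.add_sub_cancel] at this
    linarith
  · intro h k hk
    rw [Finset.mem_Icc] at hk
    have := h (k - 1) (by omega)
    rw [Nat.sub_add_cancel hk.1] at this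
    linarith

/-- A minimizer which is constant on a long block inside a true phase is close to the true
coefficient there. -/
lemma IsFusedEstimator.norm_sub_le {p : ℕ} {τ lam D : ℝ} {n : ℕ} {x βs β : ℕ → Vec p} {e : ℕ → ℝ}
    (hβ : IsFusedEstimator τ lam n x (response x βs e) β) (hlam : 0 ≤ lam) {a b : ℕ}
    (ha : 1 ≤ a) (hb : b ≤ n + 1) {v φ : Vec p} (hv : ∀ i ∈ Finset.Ico a b, β i = v)
    (hφ : ∀ i ∈ Finset.Ico a b, βs i = φ)
    (hgrow : ∀ u : Vec p, D < ‖u‖ → 2 * (n * lam) * ‖u‖ <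
      ∑ i ∈ Finset.Ico a b, (checkLoss τ (e i - inner ℝ (x i) u) - checkLoss τ (e i))) :
    ‖v - φ‖ ≤ D := by
  by_contra! hc
  have h1 := hgrow _ hc
  have h2 := hβ.sum_checkLoss_sub_le hlam ha hb hv φ
  have h3 : ∑ i ∈ Finset.Ico a b, (checkLoss τ (response x βs e i - inner ℝ (x i) v)
      - checkLoss τ (response x βs e i - inner ℝ (x i) φ))
      = ∑ i ∈ Finset.Ico a b, (checkLoss τ (e i - inner ℝ (x i) (v - φ)) - checkLoss τ (e i)) := by
    refine Finset.sum_congr rfl fun i hi => ?_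
    unfold response
    rw [hφ i hi, inner_sub_right]
    congr 2 <;> ring
  linarith

lemma tendsto_mul_delta {δ lam : ℕ → ℝ} (ht : TuningCondition δ lam) :
    Tendsto (fun n : ℕ => (n : ℝ) * δ n) atTop atTop := by
  refine tendsto_atTop_mono' _ ?_ ht.tendsto_infty
  filter_upwards [ht.ratio.eventually (gt_mem_nhds one_pos), ht.delta_pos] with n h1 h2
  rw [div_lt_one h2] at h1
  exact mul_le_mul_of_nonneg_left h1.le (Nat.cast_nonneg n)

lemma tendsto_blockRate {δ lam : ℕ → ℝ} (ht : TuningCondition δ lam) :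
    Tendsto (fun n : ℕ => (n : ℝ) * lam n / (n * δ n) + (√((n : ℝ) * δ n))⁻¹) atTop (𝓝 0) := by
  have h1 : Tendsto (fun n : ℕ => (n : ℝ) * lam n / (n * δ n)) atTop (𝓝 0) := by
    refine ht.ratio.congr' ?_
    filter_upwards [eventually_gt_atTop 0] with n hn
    have : (n : ℝ) ≠ 0 := by exact_mod_cast hn.ne'
    rw [mul_div_mul_left _ _ this]
  have h2 := (Real.tendsto_sqrt_atTop.comp (tendsto_mul_delta ht)).inv_tendsto_atTop
  simpa using h1.add h2

lemma blockRate_anti {Λ s t : ℝ} (hΛ : 0 ≤ Λ) (hs : 0 < s) (hst : s ≤ t) :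
    Λ / t + (√t)⁻¹ ≤ Λ / s + (√s)⁻¹ := by
  have : 0 < √s := Real.sqrt_pos.2 hs
  gcongr

end QuantileFused

theorem theorem3 {Ω : Type*} [MeasurableSpace Ω] (P : Measure Ω) [IsProbabilityMeasure P]
    (p : ℕ) [NeZero p] (τ : ℝ) (hτ : τ ∈ Set.Ioo (0 : ℝ) 1) (K : ℕ)
    (x βstar : ℕ → ℕ → Vec p) (ε : ℕ → Ω → ℝ) (ν : Measure ℝ) (f : ℝ → ℝ) (δ lam : ℕ → ℝ)
    (hintercept : HasIntercept x)
    (hcard : ∀ᶠ n in atTop, (changePoints n (βstar n)).card = K)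
    (hdesign : BoundedDesign x)
    (hnoise : IsNoise P ε ν f τ)
    (hpos : PositiveNearZero f)
    (heigen : EigenvalueBounds x δ)
    (hspacing : SpacingCondition K βstar δ)
    (hjump : JumpBounds K βstar)
    (htuning : TuningCondition δ lam)
    (hident : Identifiability K x βstar δ ν τ)
    (hsep : Tendsto (fun n : ℕ => ((n : ℝ) * δ n)⁻¹ * minDist K n (βstar n)) atTop atTop)
    (βhat : ℕ → Ω → ℕ → Vec p)
    (hest : ∀ᶠ n in atTop, ∀ᵐ ω ∂P, IsFusedEstimator τ (lam n) n (x n)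
      (response (x n) (βstar n) (fun i => ε i ω)) (βhat n ω)) :
    ∀ k ∈ Finset.Icc 1 (K + 1),
      IsBigOPOn P (fun n => {ω | (changePoints n (βhat n ω)).card = K})
        (fun n ω => ‖phase n (βhat n ω) k - phase n (βstar n) k‖)
        (rate K βstar lam) := by
  intro k hk η hη
  rw [Finset.mem_Icc] at hk
  obtain ⟨hk1, hkK⟩ := hk
  obtain ⟨m₀, M₀, hm₀, -, heig⟩ := heigen
  obtain ⟨c₁, -, hc₁, hx⟩ := hdesign
  obtain ⟨_, jb, -, hjb, hjmp⟩ := hjump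
  -- One share for each of the 2K + 1 blocks.
  set η' : ℝ := η / (2 * K + 1) with hη'
  have hη'0 : 0 < η' := by positivity
  obtain ⟨C, hC, r₀, hr₀, L₀, hL₀, hgrowth⟩ :=
    hnoise.exists_growth_event hτ hpos p hm₀ hη'0
  refine ⟨2 * C, by positivity, ?_⟩
  -- The radius decreases with block length, so length nδ_n is the worst case. Below r₀ the growth
  -- event applies; below jb/2 two consecutive true coefficients cannot both be close to one value.
  have hrate : ∀ᶠ n : ℕ in atTop, C * ((n : ℝ) * lam n / (n * δ n) + (√((n : ℝ) * δ n))⁻¹)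
      < min r₀ (jb / 2) := by
    have := (tendsto_blockRate htuning).const_mul C
    rw [mul_zero] at this
    exact this.eventually (gt_mem_nhds (by positivity))
  filter_upwards [hcard, heig, hjmp, htuning.lam_pos, hsep.eventually_ge_atTop 8,
    (tendsto_mul_delta htuning).eventually_ge_atTop (max 1 L₀), hrate, hest,
    eventually_ge_atTop 1] with n hcard heig hjmp hlam hsep hnδ hrate hest hn
  have hd1 : 1 ≤ (n : ℝ) * δ n := (le_max_left _ _).trans hnδ
  have hdL : L₀ ≤ (n : ℝ) * δ n := (le_max_right _ _).trans hnδ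
  set d : ℝ := (n : ℝ) * δ n with hd
  set Λ : ℝ := (n : ℝ) * lam n with hΛ
  set I : ℝ := minDist K n (βstar n) with hI
  set T : ℕ → ℕ := location n (βstar n) with hT
  have hd0 : 0 < d := by linarith
  have hn0 : (0 : ℝ) < n := by exact_mod_cast hn
  have hΛ0 : 0 < Λ := mul_pos hn0 hlam
  -- Since L ≤ 2d, the factor 8 gives gaps of at least 4L and leaves the trimmed phase a length of
  -- at least I/2.
  have hI8 : 8 * d ≤ I := by
    rw [← div_eq_inv_mul, le_div_iff₀ hd0] at hsep
    exact hsep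
  set L : ℕ := ⌈d⌉₊ with hL
  have hdLe : d ≤ L := Nat.le_ceil d
  have hL2 : (L : ℝ) ≤ 2 * d := by
    have := Nat.ceil_lt_add_one hd0.le
    linarith
  have hL1 : 1 ≤ L := Nat.ceil_pos.2 hd0
  have hTI : ∀ k ≤ K, (T k : ℝ) + I ≤ T (k + 1) := le_minDist_iff.1 le_rfl
  have hT4 : ∀ k ≤ K, T k + 4 * L ≤ T (k + 1) := fun k hk => by
    have : ((T k + 4 * L : ℕ) : ℝ) ≤ (T (k + 1) : ℕ) := by
      push_cast
      linarith [hTI k hk]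
    exact_mod_cast this
  have hT1 : ∀ k, 1 ≤ T k := one_le_location hn
  have hTn : ∀ k, T k ≤ n := location_le hn
  -- The exceptional set depends on the block alone, not on the values v and φ. Inadmissible blocks
  -- get the empty set, so that `choose` yields a total function.
  have hblock : ∀ q : ℕ × ℕ, ∃ N : Set Ω, P.real N ≤ η' ∧ (1 ≤ q.1 → q.2 ≤ n →
      d ≤ (q.2 : ℝ) - q.1 → ∀ ω ∉ N, IsFusedEstimator τ (lam n) n (x n)
        (response (x n) (βstar n) (fun i => ε i ω)) (βhat n ω) →
      ∀ v φ : Vec p, (∀ i ∈ Finset.Ico q.1 q.2, βhat n ω i = v) →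
        (∀ i ∈ Finset.Ico q.1 q.2, βstar n i = φ) →
        ‖v - φ‖ ≤ C * (Λ / ((q.2 : ℝ) - q.1) + (√((q.2 : ℝ) - q.1))⁻¹)) := by
    rintro ⟨a, b⟩
    by_cases hab : 1 ≤ a ∧ b ≤ n ∧ d ≤ (b : ℝ) - a
    · obtain ⟨ha, hb, hdab⟩ := hab
      have hlt : a < b := by
        have : (a : ℝ) < b := by linarith
        exact_mod_cast this
      have hcd : ((Finset.Ico a b).card : ℝ) = (b : ℝ) - a := by
        rw [Nat.card_Ico, Nat.cast_sub hlt.le]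
      have hmem : ∀ i ∈ Finset.Ico a b, 1 ≤ i ∧ i ≤ n := fun i hi => by
        rw [Finset.mem_Ico] at hi
        omega
      obtain ⟨N, hN, hgr⟩ := hgrowth (Finset.Ico a b) (x n) Λ hΛ0 (fun i hi => (hmem i hi).1)
        (fun i hi => (hx n i (Finset.mem_Icc.2 (hmem i hi))).trans hc₁.le)
        (by rw [hcd]; linarith)
        (fun u => by rw [hcd]; exact sum_inner_sq_ge_of_spectrum hlt (heig a b ha hlt hb hdab) u)
        (by
          rw [hcd]
          exact (mul_le_mul_of_nonneg_left (blockRate_anti hΛ0.le hd0 hdab) hC.le).trans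
            (hrate.le.trans (min_le_left _ _)))
      rw [hcd] at hgr
      exact ⟨N, hN, fun _ _ _ ω hω he v φ hv hφ =>
        he.norm_sub_le hlam.le ha (by omega) hv hφ (hgr ω hω)⟩
    · exact ⟨∅, by simpa using hη'0.le, fun h1 h2 h3 => absurd ⟨h1, h2, h3⟩ hab⟩
  choose N hN hgood using hblock
  set Bad : Set Ω := ((⋃ j ∈ Finset.Icc 1 K, N (T j - L, T j)) ∪
    ⋃ j ∈ Finset.Icc 1 K, N (T j, T j + L)) ∪ N (T (k - 1) + L, T k - L) with hBad
  have hPBad : P.real Bad ≤ η := by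
    have h1 := (measureReal_biUnion_finset_le (μ := P) (Finset.Icc 1 K)
      (fun j => N (T j - L, T j))).trans (Finset.sum_le_card_nsmul _ _ _ fun j _ => hN _)
    have h2 := (measureReal_biUnion_finset_le (μ := P) (Finset.Icc 1 K)
      (fun j => N (T j, T j + L))).trans (Finset.sum_le_card_nsmul _ _ _ fun j _ => hN _)
    have h3 := hN (T (k - 1) + L, T k - L)
    simp only [Nat.card_Icc, Nat.add_sub_cancel, nsmul_eq_mul] at h1 h2
    have h4 := measureReal_union_le (μ := P) (⋃ j ∈ Finset.Icc 1 K, N (T j - L, T j))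
      (⋃ j ∈ Finset.Icc 1 K, N (T j, T j + L))
    have h5 := measureReal_union_le (μ := P) ((⋃ j ∈ Finset.Icc 1 K, N (T j - L, T j)) ∪
      ⋃ j ∈ Finset.Icc 1 K, N (T j, T j + L)) (N (T (k - 1) + L, T k - L))
    have h6 : η' * (2 * K + 1) = η := div_mul_cancel₀ _ (by positivity)
    linarith
  have hPBad' : P Bad ≤ ENNReal.ofReal η := by
    rw [← ofReal_measureReal (measure_ne_top P Bad)]
    exact ENNReal.ofReal_le_ofReal hPBad
  refine (measure_mono_ae ?_).trans hPBad'
  filter_upwards [hest] with ω hω hmem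
  obtain ⟨hcardω, hlarge⟩ := hmem
  by_contra hnot
  have hnot : ω ∉ Bad := hnot
  simp only [hBad, Set.mem_union, Set.mem_iUnion, not_or, not_exists] at hnot
  obtain ⟨⟨hl, hr⟩, hc⟩ := hnot
  have hkT := hT4 (k - 1) (by omega)
  have hkI := hTI (k - 1) (by omega)
  rw [Nat.sub_add_cancel hk1] at hkT hkI
  have hsmall : C * (Λ / L + (√(L : ℝ))⁻¹) ≤ jb / 2 :=
    (mul_le_mul_of_nonneg_left (blockRate_anti hΛ0.le hd0 hdLe) hC.le).trans
      (hrate.le.trans (min_le_right _ _))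
  have hprev : ∀ j ∈ Finset.Icc 1 K, T (j - 1) + 4 * L ≤ T j ∧ T j + 4 * L ≤ T (j + 1) := by
    intro j hj
    rw [Finset.mem_Icc] at hj
    have h1 := hT4 (j - 1) (by omega)
    rw [Nat.sub_add_cancel hj.1] at h1
    exact ⟨h1, hT4 j hj.2⟩
  have hphase : ∀ i ∈ Finset.Ico (T (k - 1) + L) (T k - L),
      βhat n ω i = phase n (βhat n ω) k := by
    intro i hi
    rw [Finset.mem_Ico] at hi
    refine eq_phase_of_close (D := C * (Λ / L + (√(L : ℝ))⁻¹)) hn hcardω hcard hL1 hT4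
      (fun j hj => (hjmp j hj).2) (by linarith) ?_ ?_ hk1 hkK hi.1 (show i + L < T k by omega)
    · intro j hj v φ hv hφ
      have h1 := hprev j hj
      have hlen : ((T j : ℕ) : ℝ) - ((T j - L : ℕ) : ℝ) = L := by
        rw [Nat.cast_sub (by omega)]; ring
      have := hgood (T j - L, T j) (by have := hT1 (j - 1); simp only; omega) (hTn j)
        (by simp only [hlen]; exact hdLe) ω (hl j hj) hω v φ hv hφ
      simpa only [hlen] using this
    · intro j hj v φ hv hφ
      have h1 := hprev j hj
      have hlen : ((T j + L : ℕ) : ℝ) - ((T j : ℕ) : ℝ) = L := by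
        push_cast; ring
      have := hgood (T j, T j + L) (hT1 j) (by have := hTn (j + 1); simp only; omega)
        (by simp only [hlen]; exact hdLe) ω (hr j hj) hω v φ hv hφ
      simpa only [hlen] using this
  have hlen : I / 2 ≤ ((T k - L : ℕ) : ℝ) - ((T (k - 1) + L : ℕ) : ℝ) := by
    rw [Nat.cast_sub (by omega)]
    push_cast
    linarith
  have hclose := hgood (T (k - 1) + L, T k - L) (by have := hT1 (k - 1); simp only; omega)
    (by have := hTn k; simp only; omega) (by simp only; linarith) ω hc hω
    (phase n (βhat n ω) k) (phase n (βstar n) k) hphase (fun i hi => by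
      rw [Finset.mem_Ico] at hi
      refine eq_phase hn hk1 (by omega) ?_ ?_
      · show T (k - 1) ≤ i
        simp only at hi; omega
      · show i < T k
        simp only at hi; omega)
  have hI0 : 0 < I := by linarith
  have hfin : Λ / (I / 2) + (√(I / 2))⁻¹ ≤ 2 * (Λ / I + (√I)⁻¹) := by
    have h1 : Λ / (I / 2) = 2 * (Λ / I) := by field_simp
    have h2 : √I / 2 ≤ √(I / 2) := by
      refine Real.le_sqrt_of_sq_le ?_
      rw [div_pow, Real.sq_sqrt hI0.le]
      linarith
    have h3 : 0 < √I := Real.sqrt_pos.2 hI0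
    have h4 : (√(I / 2))⁻¹ ≤ (√I / 2)⁻¹ := by gcongr
    have h5 : (√I / 2)⁻¹ = 2 * (√I)⁻¹ := by rw [inv_div]; ring
    linarith
  have hub := hclose.trans (mul_le_mul_of_nonneg_left
    ((blockRate_anti hΛ0.le (by positivity : 0 < I / 2) hlen).trans hfin) hC.le)
  have hlarge : 2 * C * rate K βstar lam n < |‖phase n (βhat n ω) k - phase n (βstar n) k‖| :=
    hlarge
  rw [abs_norm] at hlarge
  unfold rate at hlarge
  rw [← hI, ← hΛ] at hlarge
  linarith
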